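/- Notation. All expectations and norms on $\{0,1\}^n$ are with respect to the uniform distribution; in particular $\|g\|_1=\mathbb{E}_x|g(x)|$. For $x\in\{0,1\}^n$, $i\in[n]$, $b\in\{0,1\}$ let $x_{i\leftarrow b}$ be $x$ with its $i$-th coordinate set to $b$, and let $\min_{x_i}f(x)=\min\{f(x_{i\leftarrow 0}),f(x_{i\leftarrow 1})\}$. A function $f:\{0,1\}^n\to\mathbb{R}$ is $a$-self-bounding if $f(x)-\min_{x_i}f(x)\le 1$ for all $x$ and $i$, and $\sum_{i=1}^n\bigl(f(x)-\min_{x_i}f(x)\bigr)\le a\,f(x)$ for all $x$. Let $\partial_i f(x)=\frac12\bigl(f(x_{i\leftarrow 1})-f(x_{i\leftarrow 0})\bigr)$ and $\mathsf{Inf}^{\kappa}_i(f)=\mathbb{E}\bigl[\,\bigl|\tfrac12\partial_i f\bigr|^{\kappa}\,\bigr]$. Theorem. There is an absolute constant $C$ such that the following holds for every integer $n\ge 0$, all reals $a>0$ and $\varepsilon>0$, and every $a$-self-bounding function $f:\{0,1\}^n\to[0,1]$. Let $$d=\Bigl\lceil \frac{4a}{\varepsilon}\log\frac{6}{\varepsilon}\Bigr\rceil,\qquad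 \alpha=3^{-2d-1}\,\frac{\varepsilon^4}{a^2},\qquad I=\{i\in[n] : \mathsf{Inf}^{4/3}_i(f)\ge\alpha\},$$ where $\log$ is the natural logarithm. Then: 1. $|I|\le a/\alpha$; 2. if $\varepsilon\le\min(1,a)$, then $a/\alpha\le 2^{C d}$, that is, $a/\alpha=2^{O(d)}$; 3. there is a real polynomial $p$ of degree at most $d$, involving only the variables $x_i$ with $i\in I$, such that $\|f-p\|_1\le\varepsilon$. (If $d<0$, which can happen only for $\varepsilon>6$, "degree at most $d$" means $p=0$.) -/

import Mathlib

noncomputable section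

namespace SelfBounding

/-- The Boolean hypercube `{0,1}^n`, with `false` for `0` and `true` for `1`. -/
abbrev Cube (n : ℕ) : Type := Fin n → Bool

/-- The expectation of `g` under the uniform distribution on the cube. -/
def expect {n : ℕ} (g : Cube n → ℝ) : ℝ :=
  (∑ x : Cube n, g x) / (2 : ℝ) ^ n

/-- The norm `‖g‖₁ = E|g|` with respect to the uniform distribution. -/
def l1Norm {n : ℕ} (g : Cube n → ℝ) : ℝ :=
  expect fun x => |g x|

/-- `min_{x_i} f(x)`: the minimum of `f` over the two values of the `i`-th coordinate,
the other coordinates being those of `x`. -/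
def minCoord {n : ℕ} (f : Cube n → ℝ) (i : Fin n) (x : Cube n) : ℝ :=
  min (f (Function.update x i false)) (f (Function.update x i true))

/-- `f` is `a`-self-bounding. -/
def IsSelfBounding {n : ℕ} (a : ℝ) (f : Cube n → ℝ) : Prop :=
  (∀ x i, f x - minCoord f i x ≤ 1) ∧
    ∀ x, ∑ i : Fin n, (f x - minCoord f i x) ≤ a * f x

/-- The discrete derivative `∂ᵢ f(x) = (f(x_{i←1}) - f(x_{i←0})) / 2`. -/
def discreteDeriv {n : ℕ} (i : Fin n) (f : Cube n → ℝ) (x : Cube n) : ℝ :=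
  (1 / 2) * (f (Function.update x i true) - f (Function.update x i false))

/-- The `ℓ_κ^κ`-influence `E[|(1/2) ∂ᵢ f|^κ]` of the `i`-th variable on `f`. -/
def influence {n : ℕ} (κ : ℝ) (i : Fin n) (f : Cube n → ℝ) : ℝ :=
  expect fun x => |(1 / 2) * discreteDeriv i f x| ^ κ

/-- The degree `d = ⌈(4a/ε) log(6/ε)⌉`, with the natural logarithm. -/
def juntaDegree (a ε : ℝ) : ℤ :=
  ⌈4 * a / ε * Real.log (6 / ε)⌉

/-- The threshold `α = 3^{-2d-1} ε^4 / a^2`. -/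
def influenceThreshold (a ε : ℝ) : ℝ :=
  (3 : ℝ) ^ (-2 * juntaDegree a ε - 1) * ε ^ 4 / a ^ 2

/-- The set `I` of the variables whose `ℓ_{4/3}^{4/3}`-influence on `f` is at least `α`. -/
def influentialVars {n : ℕ} (a ε : ℝ) (f : Cube n → ℝ) : Finset (Fin n) :=
  {i | influenceThreshold a ε ≤ influence (4 / 3) i f}

/-- The value at a point of the cube of a real polynomial in `x_1, …, x_n`. -/
def polyEval {n : ℕ} (p : MvPolynomial (Fin n) ℝ) (x : Cube n) : ℝ :=
  MvPolynomial.eval (fun i => if x i then (1 : ℝ) else 0) p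

/-- Every monomial of `p` has total degree at most the integer `d`.  For `d ≥ 0` this is
`p.totalDegree ≤ d`; for `d < 0` it says `p = 0`. -/
def DegreeAtMost {n : ℕ} (p : MvPolynomial (Fin n) ℝ) (d : ℤ) : Prop :=
  ∀ m ∈ p.support, (m.degree : ℤ) ≤ d

end SelfBounding

end

/-!
Write `f = ∑ f̂(S) χ_S` in Walsh characters, let `N χ_S = |S| χ_S`, and consider the noise semigroup
`e^{-tN}`.  Self-boundedness says that `N f ≤ (a/2) f` pointwise, and `e^{-tN}` preserves
positivity, so `e^{-tN} f ≥ e^{-at/2} f` (`IsSelfBounding.le_noise`).  Since `e^{-tN}` also preserves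
the mean, this one-sided bound gives `‖f - e^{-tN} f‖₁ ≤ a t`
(`IsSelfBounding.l1Norm_sub_noise_le`), which is `ε / 4` for `t = ε / (4a)`.

The approximating polynomial keeps the part of `e^{-tN} f` on the sets `S ⊆ I` with `|S| ≤ d`.  The
discarded part is measured in `ℓ₂`.  The sets of size above `d` are damped by
`e^{-td} ≤ ε / 6`.  The weight of the small sets that leave `I` is at most the sum over `i ∉ I` of the
low-degree weight through `i`; by Bonami's inequality (`expect_pow_four_sum_walsh_le`) and
duality, the latter is at most `4 · 3^{d-1} Inf_i^{3/2}`, where `Inf_i < α`, and `∑ᵢ Inf_i ≤ a / 2` because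
averaging `f - min_{x_i} f` over `x_i` gives `|∂ᵢ f|` (`IsSelfBounding.sum_sq_fourierCoeff_le`).
The sum of the influences also bounds `|I|`.
-/

noncomputable section

namespace SelfBounding

open Finset

/-! ### Expectations on the cube -/

section Expect

variable {n : ℕ}

lemma expect_add (g h : Cube n → ℝ) :
    expect (fun x => g x + h x) = expect g + expect h := by
  simp only [expect, sum_add_distrib, add_div]

lemma expect_sub (g h : Cube n → ℝ) :
    expect (fun x => g x - h x) = expect g - expect h := by
  simp only [expect, sum_sub_distrib, sub_div]

lemma expect_const_mul (c : ℝ) (g : Cube n → ℝ) :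
    expect (fun x => c * g x) = c * expect g := by
  simp only [expect, ← mul_sum, mul_div_assoc]

lemma expect_sum {ι : Type*} (s : Finset ι) (g : ι → Cube n → ℝ) :
    expect (fun x => ∑ j ∈ s, g j x) = ∑ j ∈ s, expect (g j) := by
  simp only [expect]
  rw [sum_comm, sum_div]

lemma expect_mono {g h : Cube n → ℝ} (H : ∀ x, g x ≤ h x) : expect g ≤ expect h := by
  unfold expect
  gcongr with x
  exact H x

lemma expect_const (c : ℝ) : expect (fun _ : Cube n => c) = c := by
  simp [expect]

lemma expect_nonneg {g : Cube n → ℝ} (H : ∀ x, 0 ≤ g x) : 0 ≤ expect g := by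
  simpa [expect_const] using expect_mono (g := fun _ => (0 : ℝ)) H

/-- The expectation may be computed by first averaging over the `i`-th coordinate. -/
lemma expect_eq_expect_average (i : Fin n) (g : Cube n → ℝ) :
    expect g =
      expect fun x => (g (Function.update x i true) + g (Function.update x i false)) / 2 := by
  have hinv : Function.Involutive fun x : Cube n => Function.update x i (!x i) := by
    intro x; simp
  have hflip : expect (fun x => g (Function.update x i (!x i))) = expect g := by
    unfold expect
    congr 1
    exact Equiv.sum_comp hinv.toPerm g
  have hpt : (fun x => (g (Function.update x i true) + g (Function.update x i false)) / 2) =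
      fun x => (1 / 2 : ℝ) * (g x + g (Function.update x i (!x i))) := by
    funext x
    have hx := Function.update_eq_self i x
    cases h : x i
    · rw [h] at hx; simp only [hx, Bool.not_false]; ring
    · rw [h] at hx; simp only [hx, Bool.not_true]; ring
  rw [hpt, expect_const_mul, expect_add, hflip]
  ring

lemma sq_expect_mul_le (g h : Cube n → ℝ) :
    expect (fun x => g x * h x) ^ 2 ≤ expect (fun x => g x ^ 2) * expect (fun x => h x ^ 2) := by
  unfold expect
  rw [div_pow, div_mul_div_comm, ← sq]
  gcongr
  exact sum_mul_sq_le_sq_mul_sq _ _ _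

lemma sq_l1Norm_le (g : Cube n → ℝ) : l1Norm g ^ 2 ≤ expect fun x => g x ^ 2 := by
  simpa [l1Norm, expect_const] using sq_expect_mul_le (fun x => |g x|) fun _ => 1

/-- Hölder's inequality with exponents `4` and `4/3`. -/
lemma expect_mul_le_holder (h g : Cube n → ℝ) :
    expect (fun x => h x * g x) ≤
      expect (fun x => h x ^ 4) ^ (1 / 4 : ℝ) *
        expect (fun x => |g x| ^ (4 / 3 : ℝ)) ^ (3 / 4 : ℝ) := by
  have H := Real.inner_le_Lp_mul_Lq (Finset.univ : Finset (Cube n)) h g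
    (p := 4) (q := 4 / 3) ⟨by norm_num, by norm_num, by norm_num⟩
  have h4 : ∀ x, |h x| ^ (4 : ℝ) = h x ^ 4 := fun x => by
    rw [show (4 : ℝ) = ((4 : ℕ) : ℝ) by norm_num, Real.rpow_natCast]
    exact Even.pow_abs (by decide) _
  simp only [h4, one_div_div] at H
  unfold expect
  have hN : (0 : ℝ) < 2 ^ n := by positivity
  rw [Real.div_rpow (sum_nonneg fun x _ => by positivity) hN.le,
    Real.div_rpow (sum_nonneg fun x _ => by positivity) hN.le, div_mul_div_comm,
    ← Real.rpow_add hN]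
  norm_num only [Real.rpow_one]
  gcongr

end Expect

/-! ### Walsh characters and the Fourier expansion -/

section Walsh

variable {n : ℕ}

/-- The sign `±1` encoding a bit, with `true ↦ 1` and `false ↦ -1`. -/
def bitSign (b : Bool) : ℝ := if b then 1 else -1

/-- The Walsh character `χ_S(x) = ∏_{i ∈ S} ±1`.  The sign convention `true ↦ 1` makes
`discreteDeriv i χ_S = χ_{S \ {i}}` hold without a sign for `i ∈ S`. -/
def walsh (S : Finset (Fin n)) (x : Cube n) : ℝ := ∏ i ∈ S, bitSign (x i)

/-- The Fourier coefficient `E[f χ_S]`. -/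
def fourierCoeff (f : Cube n → ℝ) (S : Finset (Fin n)) : ℝ :=
  expect fun x => f x * walsh S x

@[simp] lemma bitSign_true : bitSign true = 1 := rfl

@[simp] lemma bitSign_false : bitSign false = -1 := rfl

lemma bitSign_mul_self (b : Bool) : bitSign b * bitSign b = 1 := by cases b <;> simp

lemma walsh_mul_self (S : Finset (Fin n)) (x : Cube n) : walsh S x * walsh S x = 1 := by
  simp [walsh, ← prod_mul_distrib, bitSign_mul_self]

lemma walsh_insert {i : Fin n} {S : Finset (Fin n)} (hi : i ∉ S) (x : Cube n) :
    walsh (insert i S) x = bitSign (x i) * walsh S x := by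
  simp [walsh, prod_insert hi]

lemma walsh_update_of_notMem {i : Fin n} {S : Finset (Fin n)} (hi : i ∉ S) (x : Cube n)
    (b : Bool) : walsh S (Function.update x i b) = walsh S x := by
  refine prod_congr rfl fun j hj => ?_
  rw [Function.update_of_ne (ne_of_mem_of_not_mem hj hi)]

lemma walsh_insert_update {i : Fin n} {S : Finset (Fin n)} (hi : i ∉ S) (x : Cube n)
    (b : Bool) : walsh (insert i S) (Function.update x i b) = bitSign b * walsh S x := by
  rw [walsh_insert hi, walsh_update_of_notMem hi, Function.update_self]

lemma expect_bitSign_mul_eq_zero (i : Fin n) {g : Cube n → ℝ}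
    (hg : ∀ x b, g (Function.update x i b) = g x) :
    expect (fun x => bitSign (x i) * g x) = 0 := by
  rw [expect_eq_expect_average i]
  simp [hg, expect_const]

lemma expect_walsh_mul_walsh_of_mem {S T : Finset (Fin n)} {i : Fin n} (hS : i ∈ S)
    (hT : i ∉ T) : expect (fun x => walsh S x * walsh T x) = 0 := by
  obtain ⟨S', hi, rfl⟩ : ∃ S', i ∉ S' ∧ insert i S' = S :=
    ⟨S.erase i, notMem_erase i S, insert_erase hS⟩
  have := expect_bitSign_mul_eq_zero i (g := fun x => walsh S' x * walsh T x)
    (fun x b => by rw [walsh_update_of_notMem hi, walsh_update_of_notMem hT])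
  simpa only [walsh_insert hi, mul_assoc] using this

lemma expect_walsh_mul_walsh (S T : Finset (Fin n)) :
    expect (fun x => walsh S x * walsh T x) = if S = T then 1 else 0 := by
  split_ifs with h
  · subst h
    simp only [walsh_mul_self, expect_const]
  · obtain ⟨i, hi⟩ : ∃ i, ¬ (i ∈ S ↔ i ∈ T) := by
      by_contra! hc
      exact h (Finset.ext hc)
    by_cases hS : i ∈ S
    · exact expect_walsh_mul_walsh_of_mem hS (fun hT => hi (by tauto))
    · have hT : i ∈ T := by tauto
      simpa only [mul_comm] using expect_walsh_mul_walsh_of_mem hT hS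

lemma expect_sq_sum_walsh (A : Finset (Finset (Fin n))) (c : Finset (Fin n) → ℝ) :
    expect (fun x => (∑ S ∈ A, c S * walsh S x) ^ 2) = ∑ S ∈ A, c S ^ 2 := by
  have hpt : (fun x => (∑ S ∈ A, c S * walsh S x) ^ 2) =
      fun x => ∑ S ∈ A, ∑ T ∈ A, c S * c T * (walsh S x * walsh T x) := by
    funext x
    rw [sq, sum_mul_sum]
    exact sum_congr rfl fun S _ => sum_congr rfl fun T _ => by ring
  rw [hpt, expect_sum]
  refine sum_congr rfl fun S hS => ?_
  rw [expect_sum]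
  simp only [expect_const_mul, expect_walsh_mul_walsh, mul_ite, mul_one, mul_zero]
  rw [sum_ite_eq, if_pos hS, sq]

/-- The kernel of the Fourier multiplier `S ↦ r ^ |S|` is a product over the coordinates. -/
lemma sum_pow_card_mul_walsh (r : ℝ) (x y : Cube n) :
    ∑ S : Finset (Fin n), r ^ #S * (walsh S x * walsh S y) =
      ∏ i, (1 + r * (bitSign (x i) * bitSign (y i))) := by
  rw [prod_one_add, powerset_univ]
  exact sum_congr rfl fun S _ => by
    simp [walsh, prod_mul_distrib]

lemma sum_pow_card_mul_fourierCoeff (r : ℝ) (f : Cube n → ℝ) (x : Cube n) :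
    ∑ S : Finset (Fin n), r ^ #S * (fourierCoeff f S * walsh S x) =
      expect fun y => f y * ∏ i, (1 + r * (bitSign (x i) * bitSign (y i))) := by
  simp only [← sum_pow_card_mul_walsh, mul_sum, expect_sum]
  refine sum_congr rfl fun S _ => ?_
  rw [fourierCoeff, mul_comm (expect _), ← mul_assoc, ← expect_const_mul]
  congr 1; funext y; ring

lemma sum_fourierCoeff_mul_walsh (f : Cube n → ℝ) (x : Cube n) :
    ∑ S : Finset (Fin n), fourierCoeff f S * walsh S x = f x := by
  have h := sum_pow_card_mul_fourierCoeff 1 f x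
  simp only [one_pow, one_mul] at h
  rw [h]
  -- At `r = 1` the kernel is `2 ^ n` on the diagonal and vanishes off it.
  have hker : ∀ y : Cube n,
      ∏ i, (1 + bitSign (x i) * bitSign (y i)) = if x = y then (2 : ℝ) ^ n else 0 := by
    intro y
    split_ifs with hxy
    · subst hxy
      simp only [bitSign_mul_self, prod_const, card_univ, Fintype.card_fin]
      norm_num
    · obtain ⟨i, hi⟩ := Function.ne_iff.mp hxy
      refine prod_eq_zero (mem_univ i) ?_
      revert hi
      cases x i <;> cases y i <;> simp
  simp [hker, expect]

lemma sum_sq_fourierCoeff (f : Cube n → ℝ) :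
    ∑ S : Finset (Fin n), fourierCoeff f S ^ 2 = expect fun x => f x ^ 2 := by
  rw [← expect_sq_sum_walsh]
  simp only [sum_fourierCoeff_mul_walsh]

lemma expect_walsh_mul_discreteDeriv {i : Fin n} {S : Finset (Fin n)} (hi : i ∉ S)
    (f : Cube n → ℝ) :
    expect (fun x => walsh S x * discreteDeriv i f x) = fourierCoeff f (insert i S) := by
  rw [fourierCoeff, expect_eq_expect_average i (fun x => f x * walsh (insert i S) x)]
  congr 1
  funext x
  simp only [walsh_insert_update hi, bitSign_true, bitSign_false, discreteDeriv]
  ring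

end Walsh

/-! ### Hypercontractivity -/

section Bonami

variable {n : ℕ}

/-- Bonami's `(2,4)` hypercontractive inequality, in the form `‖h‖₄² ≤ ∑ 3^|S| c_S²`.  Splitting
off one coordinate writes `h = A + χ_i B`; the odd moments in `χ_i` vanish and
`E[A⁴] + 6 E[A² B²] + E[B⁴]` is bounded by Cauchy–Schwarz. -/
theorem expect_pow_four_sum_walsh_le (J : Finset (Fin n)) (c : Finset (Fin n) → ℝ) :
    expect (fun x => (∑ S ∈ J.powerset, c S * walsh S x) ^ 4) ≤
      (∑ S ∈ J.powerset, 3 ^ #S * c S ^ 2) ^ 2 := by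
  induction J using Finset.induction_on generalizing c with
  | empty => simp [walsh, expect_const, ← pow_mul]
  | insert i J hi ih =>
    set A : Cube n → ℝ := fun x => ∑ S ∈ J.powerset, c S * walsh S x with hA
    set B : Cube n → ℝ := fun x => ∑ S ∈ J.powerset, c (insert i S) * walsh S x with hB
    set α : ℝ := ∑ S ∈ J.powerset, 3 ^ #S * c S ^ 2 with hα
    set β : ℝ := ∑ S ∈ J.powerset, 3 ^ #S * c (insert i S) ^ 2 with hβ
    have hnot : ∀ S ∈ J.powerset, i ∉ S := fun S hS h => hi (mem_powerset.mp hS h)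
    have hAi : ∀ x b, A (Function.update x i b) = A x := fun x b =>
      sum_congr rfl fun S hS => by rw [walsh_update_of_notMem (hnot S hS)]
    have hBi : ∀ x b, B (Function.update x i b) = B x := fun x b =>
      sum_congr rfl fun S hS => by rw [walsh_update_of_notMem (hnot S hS)]
    have hA4 : expect (fun x => A x ^ 4) ≤ α ^ 2 := ih c
    have hB4 : expect (fun x => B x ^ 4) ≤ β ^ 2 := ih fun S => c (insert i S)
    have hα0 : 0 ≤ α := sum_nonneg fun S _ => by positivity
    have hβ0 : 0 ≤ β := sum_nonneg fun S _ => by positivity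
    have hAB : expect (fun x => A x ^ 2 * B x ^ 2) ≤ α * β := by
      refine le_of_sq_le_sq ?_ (mul_nonneg hα0 hβ0)
      refine (sq_expect_mul_le _ _).trans ?_
      simp only [← pow_mul]
      rw [mul_pow]
      exact mul_le_mul hA4 hB4 (expect_nonneg fun x => Even.pow_nonneg (by decide) _) (by positivity)
    have hlhs : (fun x => (∑ S ∈ (insert i J).powerset, c S * walsh S x) ^ 4) =
        fun x => (A x ^ 4 + 6 * (A x ^ 2 * B x ^ 2) + B x ^ 4) +
          bitSign (x i) * (4 * A x ^ 3 * B x + 4 * A x * B x ^ 3) := by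
      funext x
      have hsplit : ∑ S ∈ J.powerset, c (insert i S) * walsh (insert i S) x =
          bitSign (x i) * B x := by
        rw [hB, mul_sum]
        exact sum_congr rfl fun S hS => by rw [walsh_insert (hnot S hS)]; ring
      rw [sum_powerset_insert hi, hsplit]
      change (A x + bitSign (x i) * B x) ^ 4 = _
      have h2 : bitSign (x i) ^ 2 = 1 := by rw [sq, bitSign_mul_self]
      linear_combination (6 * A x ^ 2 * B x ^ 2 + 4 * A x * B x ^ 3 * bitSign (x i) +
        B x ^ 4 * (bitSign (x i) ^ 2 + 1)) * h2
    have hrhs : ∑ S ∈ (insert i J).powerset, 3 ^ #S * c S ^ 2 = α + 3 * β := by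
      rw [sum_powerset_insert hi, hβ, mul_sum]
      congr 1
      exact sum_congr rfl fun S hS => by
        rw [card_insert_of_notMem (hnot S hS), pow_succ]; ring
    rw [hlhs, hrhs, expect_add, expect_add, expect_add, expect_const_mul,
      expect_bitSign_mul_eq_zero i (fun x b => by rw [hAi, hBi])]
    nlinarith [sq_nonneg β]

/-- The Fourier weight of `f` on the sets of size at most `d + 1` through `i` is controlled by the
`4/3`-norm of `∂ᵢ f`: the dual form of Bonami's inequality. -/
lemma sum_sq_fourierCoeff_le_rpow (f : Cube n → ℝ) (i : Fin n) (d : ℕ) :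
    ∑ S with i ∈ S ∧ #S ≤ d + 1, fourierCoeff f S ^ 2 ≤
      3 ^ d * expect (fun x => |discreteDeriv i f x| ^ (4 / 3 : ℝ)) ^ (3 / 2 : ℝ) := by
  set J : Finset (Fin n) := univ.erase i with hJ
  have hiJ : i ∉ J := notMem_erase i _
  set c : Finset (Fin n) → ℝ := fun S => if #S ≤ d then fourierCoeff f (insert i S) else 0
    with hc
  set W : ℝ := ∑ S ∈ J.powerset, c S ^ 2 with hW
  set g : Cube n → ℝ := discreteDeriv i f with hg
  set G : ℝ := expect (fun x => |g x| ^ (4 / 3 : ℝ)) with hG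
  have hnot : ∀ S ∈ J.powerset, i ∉ S := fun S hS h => hiJ (mem_powerset.mp hS h)
  have hWeq : ∑ S with i ∈ S ∧ #S ≤ d + 1, fourierCoeff f S ^ 2 = W := by
    rw [sum_filter, ← powerset_univ, ← insert_erase (mem_univ i), ← hJ,
      sum_powerset_insert hiJ, sum_eq_zero, zero_add]
    · refine sum_congr rfl fun S hS => ?_
      rw [card_insert_of_notMem (hnot S hS)]
      by_cases h : #S ≤ d <;> simp [hc, h]
    · intro S hS
      simp [hnot S hS]
  have hW0 : 0 ≤ W := sum_nonneg fun S _ => sq_nonneg _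
  have hG0 : 0 ≤ G := expect_nonneg fun x => by positivity
  have hpair : expect (fun x => (∑ S ∈ J.powerset, c S * walsh S x) * g x) = W := by
    simp only [sum_mul, expect_sum, mul_assoc, expect_const_mul]
    refine sum_congr rfl fun S hS => ?_
    rw [hg, expect_walsh_mul_discreteDeriv (hnot S hS)]
    by_cases h : #S ≤ d <;> simp [hc, h, sq]
  have h4 : expect (fun x => (∑ S ∈ J.powerset, c S * walsh S x) ^ 4) ≤ (3 ^ d * W) ^ 2 := by
    refine (expect_pow_four_sum_walsh_le J c).trans ?_
    gcongr
    rw [hW, mul_sum]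
    refine sum_le_sum fun S _ => ?_
    by_cases h : #S ≤ d
    · gcongr
      norm_num
    · simp [hc, h]
  rw [hWeq]
  rcases hW0.eq_or_lt with hW' | hW'
  · rw [← hW']; positivity
  have hH : W ≤ (3 ^ d * W) ^ (1 / 2 : ℝ) * G ^ (3 / 4 : ℝ) := by
    calc W ≤ _ := hpair ▸ expect_mul_le_holder _ g
      _ ≤ ((3 ^ d * W) ^ 2) ^ (1 / 4 : ℝ) * G ^ (3 / 4 : ℝ) := by
        gcongr
        exact expect_nonneg fun x => by positivity
      _ = _ := by
        rw [← Real.rpow_natCast, ← Real.rpow_mul (by positivity)]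
        norm_num
  have hsq : W ^ 2 ≤ (3 ^ d * W) * G ^ (3 / 2 : ℝ) := by
    calc W ^ 2 ≤ ((3 ^ d * W) ^ (1 / 2 : ℝ) * G ^ (3 / 4 : ℝ)) ^ 2 := by gcongr
      _ = _ := by
        rw [mul_pow, ← Real.rpow_natCast, ← Real.rpow_natCast (G ^ _),
          ← Real.rpow_mul (by positivity), ← Real.rpow_mul hG0]
        norm_num
  refine le_of_mul_le_mul_right ?_ hW'
  linarith

end Bonami

/-! ### The noise semigroup on self-bounding functions -/

section Noise

variable {n : ℕ}

/-- The noise operator `e^{-tN}`, where `N χ_S = |S| χ_S`: the Fourier multiplier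
`S ↦ e^{-t|S|}`. -/
def noise (t : ℝ) (f : Cube n → ℝ) (x : Cube n) : ℝ :=
  ∑ S : Finset (Fin n), Real.exp (-t) ^ #S * (fourierCoeff f S * walsh S x)

/-- The number operator `N f = ∑ᵢ (f - Eᵢ f)`, where `Eᵢ` averages over the `i`-th coordinate. -/
def numberOp (f : Cube n → ℝ) (x : Cube n) : ℝ :=
  ∑ i : Fin n, (f x - (f (Function.update x i true) + f (Function.update x i false)) / 2)

lemma noise_zero (f : Cube n → ℝ) (x : Cube n) : noise 0 f x = f x := by
  simp [noise, sum_fourierCoeff_mul_walsh]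

/-- The noise operator is positivity preserving, since its kernel is a product of nonnegative
factors. -/
lemma noise_mono {t : ℝ} (ht : 0 ≤ t) {f g : Cube n → ℝ} (h : ∀ x, f x ≤ g x) (x : Cube n) :
    noise t f x ≤ noise t g x := by
  simp only [noise, sum_pow_card_mul_fourierCoeff]
  refine expect_mono fun y => mul_le_mul_of_nonneg_right (h y) (prod_nonneg fun i _ => ?_)
  have h1 : Real.exp (-t) ≤ 1 := Real.exp_le_one_iff.mpr (by linarith)
  have h0 := Real.exp_pos (-t)
  cases x i <;> cases y i <;> simp <;> linarith

lemma fourierCoeff_const_mul (c : ℝ) (f : Cube n → ℝ) (S : Finset (Fin n)) :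
    fourierCoeff (fun x => c * f x) S = c * fourierCoeff f S := by
  simp only [fourierCoeff, mul_assoc, expect_const_mul]

lemma noise_const_mul (t c : ℝ) (f : Cube n → ℝ) (x : Cube n) :
    noise t (fun y => c * f y) x = c * noise t f x := by
  simp only [noise, fourierCoeff_const_mul, mul_sum]
  exact sum_congr rfl fun S _ => by ring

lemma expect_noise (t : ℝ) (f : Cube n → ℝ) : expect (noise t f) = expect f := by
  have h0 : ∀ S : Finset (Fin n), expect (walsh S) = if S = ∅ then 1 else 0 := fun S => by
    have hempty : ∀ x : Cube n, walsh ∅ x = 1 := fun _ => prod_empty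
    simpa only [hempty, mul_one] using expect_walsh_mul_walsh S ∅
  unfold noise
  simp only [expect_sum, expect_const_mul, h0]
  simp [fourierCoeff, walsh]

lemma fourierCoeff_numberOp (f : Cube n → ℝ) (S : Finset (Fin n)) :
    fourierCoeff (numberOp f) S = #S * fourierCoeff f S := by
  have hterm : ∀ i : Fin n, expect (fun x =>
      (f x - (f (Function.update x i true) + f (Function.update x i false)) / 2) * walsh S x) =
        if i ∈ S then fourierCoeff f S else 0 := by
    intro i
    simp only [sub_mul, expect_sub]
    split_ifs with hi
    · obtain ⟨S', hi', rfl⟩ : ∃ S', i ∉ S' ∧ insert i S' = S :=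
        ⟨S.erase i, notMem_erase i S, insert_erase hi⟩
      have := expect_bitSign_mul_eq_zero i (g := fun x =>
        (f (Function.update x i true) + f (Function.update x i false)) / 2 * walsh S' x)
        (fun x b => by rw [walsh_update_of_notMem hi']; simp)
      rw [fourierCoeff, sub_eq_self, ← this]
      congr 1; funext x
      rw [walsh_insert hi']; ring
    · rw [sub_eq_zero, expect_eq_expect_average i]
      congr 1; funext x
      rw [walsh_update_of_notMem hi, walsh_update_of_notMem hi]; ring
  unfold fourierCoeff numberOp
  simp only [sum_mul, expect_sum, hterm]
  simp [sum_ite_mem, fourierCoeff]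

lemma hasDerivAt_noise (f : Cube n → ℝ) (x : Cube n) (t : ℝ) :
    HasDerivAt (fun s => noise s f x) (-noise t (numberOp f) x) t := by
  unfold noise
  rw [← sum_neg_distrib]
  refine HasDerivAt.fun_sum fun S _ => ?_
  have h1 : HasDerivAt (fun s : ℝ => Real.exp (-s) ^ #S)
      (-(Real.exp (-t) ^ #S * #S)) t := by
    have h2 : HasDerivAt (fun s : ℝ => Real.exp (#S * -s)) (Real.exp (#S * -t) * (#S * -1)) t :=
      (((hasDerivAt_id t).neg).const_mul (#S : ℝ)).exp
    simp only [Real.exp_nat_mul] at h2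
    refine h2.congr_deriv ?_
    ring
  refine (h1.mul_const (fourierCoeff f S * walsh S x)).congr_deriv ?_
  rw [fourierCoeff_numberOp]
  ring

/-- For a self-bounding function, the downward drift under noise is at most `(a/2) f`. -/
lemma IsSelfBounding.numberOp_le {a : ℝ} {f : Cube n → ℝ} (hf : IsSelfBounding a f)
    (x : Cube n) : numberOp f x ≤ a / 2 * f x := by
  have hpt : ∀ i, f x - (f (Function.update x i true) + f (Function.update x i false)) / 2 ≤
      1 / 2 * (f x - minCoord f i x) := by
    intro i
    have hx := Function.update_eq_self i x
    unfold minCoord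
    cases h : x i
    · rw [h] at hx; rw [hx]
      linarith [min_le_right (f x) (f (Function.update x i true))]
    · rw [h] at hx; rw [hx]
      linarith [min_le_left (f (Function.update x i false)) (f x)]
  calc numberOp f x ≤ ∑ i, 1 / 2 * (f x - minCoord f i x) := sum_le_sum fun i _ => hpt i
    _ = 1 / 2 * ∑ i, (f x - minCoord f i x) := by rw [mul_sum]
    _ ≤ a / 2 * f x := by linarith [hf.2 x]

/-- A pointwise Grönwall bound: `e^{(a/2)t} e^{-tN} f` is nondecreasing in `t`. -/
lemma IsSelfBounding.le_noise {a : ℝ} {f : Cube n → ℝ} (hf : IsSelfBounding a f) {t : ℝ}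
    (ht : 0 ≤ t) (x : Cube n) : Real.exp (-(a / 2 * t)) * f x ≤ noise t f x := by
  have hder : ∀ s, HasDerivAt (fun s => Real.exp (a / 2 * s) * noise s f x)
      (Real.exp (a / 2 * s) * (a / 2 * noise s f x - noise s (numberOp f) x)) s := by
    intro s
    have h1 : HasDerivAt (fun s : ℝ => Real.exp (a / 2 * s))
        (Real.exp (a / 2 * s) * (a / 2 * 1)) s := ((hasDerivAt_id s).const_mul (a / 2)).exp
    refine (h1.mul (hasDerivAt_noise f x s)).congr_deriv ?_
    ring
  have hmono : MonotoneOn (fun s => Real.exp (a / 2 * s) * noise s f x) (Set.Ici 0) := by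
    refine monotoneOn_of_deriv_nonneg (convex_Ici 0)
      (fun s _ => (hder s).continuousAt.continuousWithinAt)
      (fun s _ => (hder s).differentiableAt.differentiableWithinAt) fun s hs => ?_
    rw [interior_Ici, Set.mem_Ioi] at hs
    rw [(hder s).deriv]
    have := noise_mono hs.le hf.numberOp_le x
    rw [noise_const_mul] at this
    exact mul_nonneg (Real.exp_pos _).le (by linarith)
  have h := hmono (Set.mem_Ici.mpr le_rfl) (Set.mem_Ici.mpr ht) ht
  simp only [mul_zero, Real.exp_zero, one_mul, noise_zero] at h
  rw [Real.exp_neg, inv_mul_le_iff₀ (Real.exp_pos _)]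
  exact h

/-- The function `f - e^{-tN} f` has mean zero, so its `ℓ₁` norm is twice the mean of its positive
part, and the positive part is controlled by `IsSelfBounding.le_noise`. -/
lemma IsSelfBounding.l1Norm_sub_noise_le {a : ℝ} (ha : 0 ≤ a) {f : Cube n → ℝ}
    (hf : IsSelfBounding a f) (h01 : ∀ x, f x ∈ Set.Icc (0 : ℝ) 1) {t : ℝ} (ht : 0 ≤ t) :
    l1Norm (fun x => f x - noise t f x) ≤ a * t := by
  have hpt : ∀ x, |f x - noise t f x| ≤ a * t - (f x - noise t f x) := by
    intro x
    have h1 := hf.le_noise ht x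
    have h2 := Real.add_one_le_exp (-(a / 2 * t))
    have h3 : f x - noise t f x ≤ a / 2 * t := by
      nlinarith [(h01 x).1, (h01 x).2, mul_nonneg ha ht]
    have := mul_nonneg ha ht
    rw [abs_le]
    constructor <;> linarith
  refine (expect_mono hpt).trans_eq ?_
  rw [expect_sub, expect_const, expect_sub, expect_noise, sub_self, sub_zero]

end Noise

/-! ### Influences -/

section Influence

variable {n : ℕ}

lemma influence_nonneg (κ : ℝ) (i : Fin n) (f : Cube n → ℝ) : 0 ≤ influence κ i f :=
  expect_nonneg fun _ => by positivity

/-- Averaging `f - min_{x_i} f` over the `i`-th coordinate gives `|∂ᵢ f|`. -/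
lemma expect_sub_minCoord (i : Fin n) (f : Cube n → ℝ) :
    expect (fun x => f x - minCoord f i x) = expect fun x => |discreteDeriv i f x| := by
  rw [expect_eq_expect_average i]
  congr 1; funext x
  simp only [minCoord, discreteDeriv, Function.update_idem]
  rw [abs_mul, min_def, abs_of_pos (by norm_num : (0 : ℝ) < 1 / 2)]
  split_ifs with h
  · rw [abs_of_nonneg (by linarith)]; ring
  · rw [abs_of_nonpos (by linarith)]; ring

lemma IsSelfBounding.sum_influence_le {a : ℝ} (ha : 0 ≤ a) {f : Cube n → ℝ}
    (hf : IsSelfBounding a f) (h01 : ∀ x, f x ∈ Set.Icc (0 : ℝ) 1) :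
    ∑ i, influence (4 / 3) i f ≤ a / 2 := by
  have hle : ∀ i, influence (4 / 3) i f ≤ 1 / 2 * expect fun x => f x - minCoord f i x := by
    intro i
    rw [expect_sub_minCoord, ← expect_const_mul]
    refine expect_mono fun x => ?_
    have h1 := h01 (Function.update x i true)
    have h0 := h01 (Function.update x i false)
    have hb : |(1 / 2) * discreteDeriv i f x| ≤ 1 := by
      rw [abs_le, discreteDeriv]
      constructor <;> linarith [h1.1, h1.2, h0.1, h0.2]
    calc |(1 / 2) * discreteDeriv i f x| ^ (4 / 3 : ℝ)
        ≤ |(1 / 2) * discreteDeriv i f x| ^ (1 : ℝ) :=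
          Real.rpow_le_rpow_of_exponent_ge_of_imp (abs_nonneg _) hb (by norm_num)
            (fun _ h => by norm_num at h)
      _ = 1 / 2 * |discreteDeriv i f x| := by
          rw [Real.rpow_one, abs_mul, abs_of_pos (by norm_num : (0 : ℝ) < 1 / 2)]
  calc ∑ i, influence (4 / 3) i f
      ≤ ∑ i, 1 / 2 * expect fun x => f x - minCoord f i x := sum_le_sum fun i _ => hle i
    _ = 1 / 2 * expect fun x => ∑ i, (f x - minCoord f i x) := by rw [← mul_sum, expect_sum]
    _ ≤ 1 / 2 * expect fun _ => a := by
        gcongr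
        refine expect_mono fun x => (hf.2 x).trans ?_
        nlinarith [(h01 x).2]
    _ = a / 2 := by rw [expect_const]; ring

lemma influenceThreshold_pos {a ε : ℝ} (ha : 0 < a) (hε : 0 < ε) :
    0 < influenceThreshold a ε := by
  unfold influenceThreshold
  positivity

lemma IsSelfBounding.card_influentialVars_le {a ε : ℝ} (ha : 0 < a) (hε : 0 < ε)
    {f : Cube n → ℝ} (hf : IsSelfBounding a f) (h01 : ∀ x, f x ∈ Set.Icc (0 : ℝ) 1) :
    (#(influentialVars a ε f) : ℝ) ≤ a / influenceThreshold a ε := by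
  rw [le_div_iff₀ (influenceThreshold_pos ha hε), ← nsmul_eq_mul]
  calc #(influentialVars a ε f) • influenceThreshold a ε
      ≤ ∑ i ∈ influentialVars a ε f, influence (4 / 3) i f :=
        card_nsmul_le_sum _ _ _ fun i hi => (mem_filter.mp hi).2
    _ ≤ ∑ i, influence (4 / 3) i f :=
        sum_le_sum_of_subset_of_nonneg (subset_univ _) fun i _ _ => influence_nonneg _ _ _
    _ ≤ a := (hf.sum_influence_le ha.le h01).trans (by linarith)

lemma expect_rpow_discreteDeriv (i : Fin n) (f : Cube n → ℝ) :
    expect (fun x => |discreteDeriv i f x| ^ (4 / 3 : ℝ)) ^ (3 / 2 : ℝ) =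
      4 * influence (4 / 3) i f ^ (3 / 2 : ℝ) := by
  have h : expect (fun x => |discreteDeriv i f x| ^ (4 / 3 : ℝ)) =
      2 ^ (4 / 3 : ℝ) * influence (4 / 3) i f := by
    rw [influence, ← expect_const_mul]
    congr 1; funext x
    rw [← Real.mul_rpow (by norm_num) (abs_nonneg _), abs_mul,
      abs_of_pos (by norm_num : (0 : ℝ) < 1 / 2)]
    congr 1; ring
  rw [h, Real.mul_rpow (by positivity) (influence_nonneg _ _ _), ← Real.rpow_mul (by norm_num)]
  norm_num

/-- Friedgut's argument: the low-degree Fourier weight on the sets that meet the non-influential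
variables is small. -/
lemma IsSelfBounding.sum_sq_fourierCoeff_le {a ε : ℝ} (ha : 0 < a) (hε : 0 < ε)
    {f : Cube n → ℝ} (hf : IsSelfBounding a f) (h01 : ∀ x, f x ∈ Set.Icc (0 : ℝ) 1) {d : ℕ}
    (hd : juntaDegree a ε = d + 1) :
    ∑ S with ¬ S ⊆ influentialVars a ε f ∧ #S ≤ d + 1, fourierCoeff f S ^ 2 ≤
      2 / 5 * ε ^ 2 := by
  set α := influenceThreshold a ε with hα
  have hα0 : 0 < α := influenceThreshold_pos ha hε
  have hsqrt : √α ≤ 3 / 5 * (3 ^ (d + 1))⁻¹ * (ε ^ 2 / a) := by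
    refine Real.sqrt_le_iff.mpr ⟨by positivity, ?_⟩
    have hz : (3 : ℝ) ^ (-2 * juntaDegree a ε - 1) = 1 / 3 * ((3 ^ (d + 1))⁻¹) ^ 2 := by
      rw [hd, zpow_sub₀ (by norm_num), zpow_mul', ← Nat.cast_succ, zpow_natCast]
      norm_num [← pow_mul, zpow_neg]
      ring
    rw [hα, influenceThreshold, hz]
    have : 0 ≤ ((3 : ℝ) ^ (d + 1))⁻¹ ^ 2 * (ε ^ 4 / a ^ 2) := by positivity
    calc 1 / 3 * ((3 : ℝ) ^ (d + 1))⁻¹ ^ 2 * ε ^ 4 / a ^ 2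
        = 1 / 3 * (((3 : ℝ) ^ (d + 1))⁻¹ ^ 2 * (ε ^ 4 / a ^ 2)) := by ring
      _ ≤ 9 / 25 * (((3 : ℝ) ^ (d + 1))⁻¹ ^ 2 * (ε ^ 4 / a ^ 2)) := by linarith
      _ = _ := by ring
  have hi : ∀ i ∉ influentialVars a ε f,
      ∑ S with i ∈ S ∧ #S ≤ d + 1, fourierCoeff f S ^ 2 ≤
        4 / 5 * (ε ^ 2 / a) * influence (4 / 3) i f := by
    intro i hi
    have hlt : influence (4 / 3) i f ≤ α := by
      by_contra! h
      exact hi (mem_filter.mpr ⟨mem_univ _, h.le⟩)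
    have h0 := influence_nonneg (4 / 3) i f
    refine (sum_sq_fourierCoeff_le_rpow f i d).trans ?_
    rw [expect_rpow_discreteDeriv]
    have hpow : influence (4 / 3) i f ^ (3 / 2 : ℝ) ≤ √α * influence (4 / 3) i f := by
      rw [show (3 / 2 : ℝ) = 1 / 2 + 1 by norm_num,
        Real.rpow_add_of_nonneg h0 (by norm_num) (by norm_num), Real.rpow_one,
        ← Real.sqrt_eq_rpow]
      gcongr
    calc (3 : ℝ) ^ d * (4 * influence (4 / 3) i f ^ (3 / 2 : ℝ))
        ≤ 3 ^ d * (4 * (3 / 5 * (3 ^ (d + 1))⁻¹ * (ε ^ 2 / a) * influence (4 / 3) i f)) := by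
          gcongr
          exact hpow.trans (by gcongr)
      _ = _ := by
          rw [pow_succ]
          field_simp
  -- Each set `S ⊄ I` is counted at least once, for some `i ∈ S \ I`.
  have hcover : ∑ S with ¬ S ⊆ influentialVars a ε f ∧ #S ≤ d + 1, fourierCoeff f S ^ 2 ≤
      ∑ i ∈ univ \ influentialVars a ε f,
        ∑ S with i ∈ S ∧ #S ≤ d + 1, fourierCoeff f S ^ 2 := by
    simp only [sum_filter]
    rw [sum_comm]
    refine sum_le_sum fun S _ => ?_
    have hnn : ∀ i ∈ univ \ influentialVars a ε f,
        0 ≤ if i ∈ S ∧ #S ≤ d + 1 then fourierCoeff f S ^ 2 else 0 :=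
      fun i _ => by split_ifs <;> positivity
    split_ifs with hS
    · obtain ⟨i, hiS, hiI⟩ := not_subset.mp hS.1
      refine le_trans ?_ (single_le_sum hnn (mem_sdiff.mpr ⟨mem_univ i, hiI⟩))
      rw [if_pos ⟨hiS, hS.2⟩]
    · exact sum_nonneg hnn
  calc _ ≤ _ := hcover
    _ ≤ ∑ i ∈ univ \ influentialVars a ε f, 4 / 5 * (ε ^ 2 / a) * influence (4 / 3) i f :=
        sum_le_sum fun i hmem => hi i (by simpa using hmem)
    _ ≤ ∑ i, 4 / 5 * (ε ^ 2 / a) * influence (4 / 3) i f :=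
        sum_le_sum_of_subset_of_nonneg (subset_univ _) fun i _ _ =>
          mul_nonneg (by positivity) (influence_nonneg _ _ _)
    _ ≤ 4 / 5 * (ε ^ 2 / a) * (a / 2) := by
        rw [← mul_sum]
        gcongr
        exact hf.sum_influence_le ha.le h01
    _ = 2 / 5 * ε ^ 2 := by field_simp; ring

end Influence

/-! ### The approximating polynomial -/

section Polynomial

variable {n : ℕ}

/-- The polynomial `∏_{i ∈ S} (2 X_i - 1)`, which takes the values of the Walsh character `χ_S`
on the cube. -/
def walshPoly (S : Finset (Fin n)) : MvPolynomial (Fin n) ℝ :=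
  ∏ i ∈ S, (MvPolynomial.C 2 * MvPolynomial.X i - MvPolynomial.C 1)

lemma polyEval_walshPoly (S : Finset (Fin n)) (x : Cube n) :
    polyEval (walshPoly S) x = walsh S x := by
  simp only [polyEval, walshPoly, walsh, map_prod]
  refine prod_congr rfl fun i _ => ?_
  cases h : x i <;> simp [h]; norm_num

lemma totalDegree_walshPoly_le (S : Finset (Fin n)) : (walshPoly S).totalDegree ≤ #S := by
  refine (MvPolynomial.totalDegree_finsetProd _ _).trans ?_
  refine (sum_le_card_nsmul S _ 1 fun i _ => ?_).trans_eq (by simp)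
  refine (MvPolynomial.totalDegree_sub_C_le _ _).trans ?_
  refine (MvPolynomial.totalDegree_mul _ _).trans ?_
  simp

lemma vars_walshPoly_subset (S : Finset (Fin n)) : (walshPoly S).vars ⊆ S := by
  refine (MvPolynomial.vars_prod _).trans (biUnion_subset.mpr fun i hi => ?_)
  refine (MvPolynomial.vars_sub_subset _).trans (union_subset ?_ (by simp))
  refine (MvPolynomial.vars_mul _ _).trans (union_subset (by simp) ?_)
  simpa using hi

/-- A Walsh expansion supported on sets `S ⊆ I` with `|S| ≤ d` is given by a polynomial of degree
at most `d` in the variables `I`. -/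
lemma exists_polyEval_eq_sum_walsh (I : Finset (Fin n)) (d : ℕ) (c : Finset (Fin n) → ℝ) :
    ∃ p : MvPolynomial (Fin n) ℝ, DegreeAtMost p d ∧ p.vars ⊆ I ∧
      ∀ x, polyEval p x = ∑ S with S ⊆ I ∧ #S ≤ d, c S * walsh S x := by
  refine ⟨∑ S with S ⊆ I ∧ #S ≤ d, MvPolynomial.C (c S) * walshPoly S, ?_, ?_, ?_⟩
  · intro m hm
    have hdeg : (∑ S with S ⊆ I ∧ #S ≤ d,
        MvPolynomial.C (c S) * walshPoly S).totalDegree ≤ d := by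
      refine MvPolynomial.totalDegree_finsetSum_le fun S hS => ?_
      refine (MvPolynomial.totalDegree_mul _ _).trans ?_
      rw [MvPolynomial.totalDegree_C, zero_add]
      exact (totalDegree_walshPoly_le S).trans (mem_filter.mp hS).2.2
    exact_mod_cast (MvPolynomial.le_totalDegree hm).trans hdeg
  · refine (MvPolynomial.vars_sum_subset _ _).trans (biUnion_subset.mpr fun S hS => ?_)
    refine (MvPolynomial.vars_mul _ _).trans (union_subset (by simp) ?_)
    exact (vars_walshPoly_subset S).trans (mem_filter.mp hS).2.1
  · intro x
    have h := fun S : Finset (Fin n) => polyEval_walshPoly S x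
    simp only [polyEval] at h ⊢
    simp only [map_sum, map_mul, MvPolynomial.eval_C, h]

lemma IsSelfBounding.exists_junta_approx {a ε : ℝ} (ha : 0 < a) (hε : 0 < ε) (hε1 : ε ≤ 1)
    {f : Cube n → ℝ} (hf : IsSelfBounding a f) (h01 : ∀ x, f x ∈ Set.Icc (0 : ℝ) 1) :
    ∃ p : MvPolynomial (Fin n) ℝ, DegreeAtMost p (juntaDegree a ε) ∧
      p.vars ⊆ influentialVars a ε f ∧ l1Norm (fun x => f x - polyEval p x) ≤ ε := by
  have hlog : 0 < Real.log (6 / ε) := Real.log_pos (by rw [lt_div_iff₀ hε]; linarith)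
  obtain ⟨d, hd⟩ : ∃ d : ℕ, juntaDegree a ε = d + 1 := by
    have : 0 < juntaDegree a ε := Int.ceil_pos.mpr (by positivity)
    exact ⟨(juntaDegree a ε - 1).toNat, by omega⟩
  set I := influentialVars a ε f with hI
  -- This noise rate makes the `ℓ₁` error `ε / 4` and damps the degrees above `d` by `ε / 6`.
  set t : ℝ := ε / (4 * a) with ht
  have ht0 : 0 < t := by positivity
  have hdamp : Real.exp (-t) ^ (d + 1) ≤ ε / 6 := by
    have hceil : 4 * a / ε * Real.log (6 / ε) ≤ (d + 1 : ℕ) := by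
      have := Int.le_ceil (4 * a / ε * Real.log (6 / ε))
      rw [← juntaDegree, hd] at this
      exact_mod_cast this
    have h1 : Real.log (6 / ε) ≤ (d + 1 : ℕ) * t := by
      calc Real.log (6 / ε) = 4 * a / ε * Real.log (6 / ε) * t := by rw [ht]; field_simp
        _ ≤ _ := by gcongr
    rw [← Real.exp_nat_mul]
    calc Real.exp ((d + 1 : ℕ) * -t) ≤ Real.exp (-Real.log (6 / ε)) :=
          Real.exp_le_exp.mpr (by linarith)
      _ = ε / 6 := by rw [Real.exp_neg, Real.exp_log (by positivity), inv_div]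
  set c : Finset (Fin n) → ℝ := fun S => Real.exp (-t) ^ #S * fourierCoeff f S with hc
  obtain ⟨p, hpdeg, hpvars, hpeval⟩ := exists_polyEval_eq_sum_walsh I (d + 1) c
  refine ⟨p, by rw [hd]; exact_mod_cast hpdeg, hpvars, ?_⟩
  have hexp1 : Real.exp (-t) ≤ 1 := Real.exp_le_one_iff.mpr (by linarith)
  have hrem : ∀ x, noise t f x - polyEval p x =
      ∑ S with ¬ (S ⊆ I ∧ #S ≤ d + 1), c S * walsh S x := by
    intro x
    rw [hpeval, sub_eq_iff_eq_add', sum_filter_add_sum_filter_not]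
    exact sum_congr rfl fun S _ => by rw [hc]; ring
  have hsum : ∑ S with ¬ (S ⊆ I ∧ #S ≤ d + 1), c S ^ 2 ≤ (3 / 4 * ε) ^ 2 := by
    have hpt : ∀ S : Finset (Fin n), (if ¬ (S ⊆ I ∧ #S ≤ d + 1) then c S ^ 2 else 0) ≤
        (ε / 6) ^ 2 * fourierCoeff f S ^ 2 +
          if ¬ S ⊆ I ∧ #S ≤ d + 1 then fourierCoeff f S ^ 2 else 0 := by
      intro S
      have h0 : 0 ≤ (ε / 6) ^ 2 * fourierCoeff f S ^ 2 := by positivity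
      have h1 : 0 ≤ fourierCoeff f S ^ 2 := by positivity
      by_cases hcard : #S ≤ d + 1
      · by_cases hSI : S ⊆ I
        · simpa [hcard, hSI] using h0
        · have : c S ^ 2 ≤ fourierCoeff f S ^ 2 := by
            rw [hc]
            simp only [mul_pow]
            exact mul_le_of_le_one_left h1
              (pow_le_one₀ (by positivity) (pow_le_one₀ (by positivity) hexp1))
          simp only [hSI, hcard, false_and, not_false_eq_true, and_self, if_true]
          linarith
      · have : c S ^ 2 ≤ (ε / 6) ^ 2 * fourierCoeff f S ^ 2 := by
          rw [hc]
          simp only [mul_pow _ (fourierCoeff f S)]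
          gcongr
          exact (pow_le_pow_of_le_one (by positivity) hexp1 (by omega)).trans hdamp
        simpa [hcard] using this
    have hE : ∑ S : Finset (Fin n), fourierCoeff f S ^ 2 ≤ 1 := by
      rw [sum_sq_fourierCoeff]
      refine (expect_mono fun x => ?_).trans_eq (expect_const 1)
      exact pow_le_one₀ (h01 x).1 (h01 x).2
    rw [sum_filter]
    refine (sum_le_sum fun S _ => hpt S).trans ?_
    calc _
        = (ε / 6) ^ 2 * ∑ S : Finset (Fin n), fourierCoeff f S ^ 2 +
            ∑ S with ¬ S ⊆ I ∧ #S ≤ d + 1, fourierCoeff f S ^ 2 := by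
          rw [sum_add_distrib, mul_sum, sum_filter]
      _ ≤ (ε / 6) ^ 2 * 1 + 2 / 5 * ε ^ 2 := by
          gcongr
          exact hf.sum_sq_fourierCoeff_le ha hε h01 hd
      _ ≤ (3 / 4 * ε) ^ 2 := by nlinarith [sq_nonneg ε]
  have htrunc : l1Norm (fun x => noise t f x - polyEval p x) ≤ 3 / 4 * ε := by
    refine le_of_sq_le_sq ((sq_l1Norm_le _).trans ?_) (by positivity)
    simp only [hrem, expect_sq_sum_walsh]
    exact hsum
  have hnoise := hf.l1Norm_sub_noise_le ha.le h01 ht0.le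
  have hat : a * t = ε / 4 := by rw [ht]; field_simp
  calc l1Norm (fun x => f x - polyEval p x)
      ≤ expect fun x => |f x - noise t f x| + |noise t f x - polyEval p x| :=
        expect_mono fun x => abs_sub_le _ _ _
    _ = l1Norm (fun x => f x - noise t f x) + l1Norm (fun x => noise t f x - polyEval p x) :=
        expect_add _ _
    _ ≤ ε := by linarith

end Polynomial

/-! ### The size of the junta -/

/-- Here `a/ε ≤ d`, so `(a/ε)³ ≤ 2^{3d}`, while `1/ε ≤ e^{d/4} ≤ 2^d`. -/
lemma div_influenceThreshold_le {a ε : ℝ} (hε : 0 < ε) (hε1 : ε ≤ 1) (hεa : ε ≤ a) :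
    a / influenceThreshold a ε ≤ (2 : ℝ) ^ ((10 : ℝ) * (juntaDegree a ε : ℝ)) := by
  have ha : 0 < a := hε.trans_le hεa
  have hlog6 : 1 ≤ Real.log 6 := by
    rw [Real.le_log_iff_exp_le (by norm_num)]
    linarith [Real.exp_one_lt_d9]
  have hlog : 1 ≤ Real.log (6 / ε) := by
    refine hlog6.trans (Real.log_le_log (by norm_num) ?_)
    rw [le_div_iff₀ hε]; linarith
  have hr : 1 ≤ a / ε := (one_le_div hε).mpr hεa
  obtain ⟨d, hd⟩ : ∃ d : ℕ, juntaDegree a ε = d := by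
    have : 0 ≤ juntaDegree a ε := Int.ceil_nonneg (by positivity)
    exact ⟨(juntaDegree a ε).toNat, by omega⟩
  have hceil : 4 * (a / ε) * Real.log (6 / ε) ≤ d := by
    have := Int.le_ceil (4 * a / ε * Real.log (6 / ε))
    rw [← juntaDegree, hd] at this
    rw [← mul_div_assoc]
    exact_mod_cast this
  have hrd : a / ε ≤ d := by nlinarith
  have hd1 : 1 ≤ d := by exact_mod_cast hr.trans hrd
  have hd2 : (d : ℝ) ≤ 2 ^ d := by exact_mod_cast Nat.lt_two_pow_self.le
  have hinv : 1 / ε ≤ 2 ^ d := by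
    have hle : Real.log (6 / ε) ≤ d * Real.log 2 := by
      nlinarith [Real.log_two_gt_d9, mul_nonneg (sub_nonneg.mpr hr) (zero_le_one.trans hlog)]
    rw [← Real.log_pow, Real.log_le_log_iff (by positivity) (by positivity)] at hle
    refine le_trans ?_ hle
    gcongr
    norm_num
  have hz : (3 : ℝ) ^ (-2 * juntaDegree a ε - 1) = (3 ^ (2 * d + 1))⁻¹ := by
    rw [hd, ← zpow_natCast, ← zpow_neg]
    congr 1
    push_cast
    ring
  have hrw : (2 : ℝ) ^ ((10 : ℝ) * (juntaDegree a ε : ℝ)) = 2 ^ (10 * d) := by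
    rw [hd, ← Real.rpow_natCast]
    push_cast
    rfl
  rw [influenceThreshold, hz, hrw]
  have h3 : (3 : ℝ) ^ (2 * d + 1) ≤ 2 ^ (6 * d) := by
    calc (3 : ℝ) ^ (2 * d + 1) ≤ 3 ^ (3 * d) := by gcongr; exacts [by norm_num, by omega]
      _ ≤ 4 ^ (3 * d) := by gcongr; norm_num
      _ = 2 ^ (6 * d) := by
        rw [show (4 : ℝ) = 2 ^ 2 by norm_num, ← pow_mul]; congr 1; ring
  calc a / ((3 ^ (2 * d + 1))⁻¹ * ε ^ 4 / a ^ 2)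
      = 3 ^ (2 * d + 1) * (a / ε) ^ 3 * (1 / ε) := by field_simp
    _ ≤ 2 ^ (6 * d) * (2 ^ d) ^ 3 * 2 ^ d := by
        gcongr
        exact hrd.trans hd2
    _ = 2 ^ (10 * d) := by rw [← pow_mul, ← pow_add, ← pow_add]; congr 1; ring

end SelfBounding

end

theorem mainTheorem1 :
    ∃ C : ℝ, ∀ (n : ℕ) (a ε : ℝ) (f : SelfBounding.Cube n → ℝ),
      0 < a → 0 < ε →
      (∀ x, f x ∈ Set.Icc (0 : ℝ) 1) →
      SelfBounding.IsSelfBounding a f →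
      (((SelfBounding.influentialVars a ε f).card : ℝ) ≤
          a / SelfBounding.influenceThreshold a ε) ∧
      (ε ≤ 1 → ε ≤ a →
        a / SelfBounding.influenceThreshold a ε ≤
          (2 : ℝ) ^ (C * (SelfBounding.juntaDegree a ε : ℝ))) ∧
      ∃ p : MvPolynomial (Fin n) ℝ,
        SelfBounding.DegreeAtMost p (SelfBounding.juntaDegree a ε) ∧
        p.vars ⊆ SelfBounding.influentialVars a ε f ∧
        SelfBounding.l1Norm (fun x => f x - SelfBounding.polyEval p x) ≤ ε := by
  refine ⟨10, fun n a ε f ha hε h01 hf => ⟨hf.card_influentialVars_le ha hε h01,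
    fun hε1 hεa => SelfBounding.div_influenceThreshold_le hε hε1 hεa, ?_⟩⟩
  rcases le_or_gt ε 1 with hε1 | hε1
  · exact hf.exists_junta_approx ha hε hε1 h01
  · -- For `ε > 1` the zero polynomial is close enough, and it has every degree bound.
    refine ⟨0, fun m hm => by simp at hm, by simp, ?_⟩
    refine (SelfBounding.expect_mono fun x => ?_).trans
      ((SelfBounding.expect_const 1).trans_le hε1.le)
    simpa [SelfBounding.polyEval, abs_of_nonneg (h01 x).1] using (h01 x).2
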